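/- For a group $H$ let $\gamma_1(H)=H$ and $\gamma_{i+1}(H)=[\gamma_i(H),H]$ denote the terms of its lower central series. For $l\ge 1$ and a tuple $\mathbf{c}=(c_1,\ldots,c_l)$ of positive integers define the iterated lower central series by $\gamma_{(c_1+1)}(H)=\gamma_{c_1+1}(H)$ and, for $l>1$, $\gamma_{(c_1+1,\ldots,c_l+1)}(H)=\gamma_{c_l+1}\bigl(\gamma_{(c_1+1,\ldots,c_{l-1}+1)}(H)\bigr)$; the class $\mathcal{N}_{\mathbf{c}}$ of polynilpotent groups of class row $\mathbf{c}$ consists of the groups $H$ with $\gamma_{(c_1+1,\ldots,c_l+1)}(H)=1$. Let $d\ge 1$, let $F$ be an (absolutely) free group of rank $d$, and let $G$ be a free centre-by-$\mathcal{N}_{\mathbf{c}}$ group of rank $d$, that is, a group isomorphic to $$F/[\gamma_{(c_1+1,\ldots,c_l+1)}(F),F].$$ A group has the Magnus property if, whenever two of its elements $g,h$ generate the same normal subgroup, $g$ is conjugate to $h$ or to $h^{-1}$. Then $G$ has the Magnus property if and only if $G$ is nilpotent of class at most $2$; equivalently, if and only if $d=1$ or $\mathbf{c}=(1)$. -/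

import Mathlib

/-- A group `G` has the Magnus property if any two elements `g`, `h` with the same normal closure
are such that `g` is conjugate to `h` or to `h⁻¹`. -/
def MagnusProperty (G : Type*) [Group G] : Prop :=
  ∀ g h : G, Subgroup.normalClosure {g} = Subgroup.normalClosure {h} →
    IsConj g h ∨ IsConj g h⁻¹

/-- The term `γ_(c₁+1,…,c_l+1)(G)` of the iterated lower central series, for `c = [c₁, …, c_l]`.
It is obtained from `G` by passing successively to `γ_(c₁+1)`, then to `γ_(c₂+1)` of the result,
and so on. Mathlib's `H.lowerCentralSeries n` is `γ_(n+1)(H)`: it starts with `H` at `n = 0`. -/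
def iteratedLowerCentral (G : Type*) [Group G] (c : List ℕ) : Subgroup G :=
  c.foldl (fun H n => H.lowerCentralSeries n) ⊤

theorem lowerCentralSeries_normal_of_normal {G : Type*} [Group G] (H : Subgroup G)
    (hH : H.Normal) (n : ℕ) : (H.lowerCentralSeries n).Normal := by
  induction n with
  | zero => exact hH
  | succ n ih => exact Subgroup.commutator_normal _ _

theorem foldl_lowerCentralSeries_normal {G : Type*} [Group G] (c : List ℕ) :
    ∀ H : Subgroup G, H.Normal →
      (c.foldl (fun H n => H.lowerCentralSeries n) H).Normal := by
  induction c with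
  | nil => exact fun H hH => hH
  | cons n c ih => exact fun H hH => ih _ (lowerCentralSeries_normal_of_normal H hH n)

instance iteratedLowerCentral_normal (G : Type*) [Group G] (c : List ℕ) :
    (iteratedLowerCentral G c).Normal :=
  foldl_lowerCentralSeries_normal c ⊤ inferInstance

/-- The free centre-by-(polynilpotent of class row `c`) group of rank `d`: the quotient
`F / [γ_(c₁+1,…,c_l+1)(F), F]` of the absolutely free group `F` on `d` generators. -/
abbrev FreeCentreByPolynilpotent (d : ℕ) (c : List ℕ) : Type :=
  FreeGroup (Fin d) ⧸
    ⁅iteratedLowerCentral (FreeGroup (Fin d)) c, (⊤ : Subgroup (FreeGroup (Fin d)))⁆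

/-! If d = 1 or c = (1), G is free nilpotent of class at most two. There the normal closure of g
consists of the elements [u,g]g^k, and torsion-freeness of G/G' and G' leaves only conjugacy up to
inversion (`magnusProperty_of_class_two`). Torsion-freeness of G' is read off the quadratic Magnus
coefficients.

Otherwise a retraction reduces to F = ⟨x, y⟩. Let N be the iterated term, so N ≤ γ₃(F), and N ≠ 1
because F is not solvable. Any z ∈ N is central modulo [N,F] and lies in F', so x and xz have the
same normal closure there. The Magnus property would make them conjugate modulo [N,F]; likewise for
y and yz.

Let F act on power series by x ↦ 1 + X, y ↦ 1 + Y. The action is faithful, so there is a largest n ≥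
3 with N in the n-th dimension subgroup. Let f be the degree-n term of z. Conjugacy makes f a
commutator with X and with Y, and, since the transvection x ↦ xy preserves N, also with X - Y.
Moreover f is killed by the derivations sending one letter to 1 and the other to 0. These conditions
force f = 0 (`eq_zero_of_commutators`), so N lies one step deeper, a contradiction. The same n shows
γ₃(F) is not contained in [N,F], so G does not have class at most two. -/

/-- Noncommutative formal power series over `ℤ` in the letters `α`, as functions on words. -/
abbrev WordSeries (α : Type*) := List α → ℤ

/-! ### Power series on words and the Magnus representation -/

namespace WordSeries

variable {α : Type*}

/-- The series `1`. -/
def one : WordSeries α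
  | [] => 1
  | _ :: _ => 0

@[simp] theorem one_nil : (one : WordSeries α) [] = 1 := rfl
@[simp] theorem one_cons (a : α) (w : List α) : (one : WordSeries α) (a :: w) = 0 := rfl

/-- The series vanishing on all words of length less than `n`. -/
def orderGE (α : Type*) (n : ℕ) : AddSubgroup (WordSeries α) where
  carrier := {f | ∀ w, w.length < n → f w = 0}
  add_mem' hf hg w hw := by simp [hf w hw, hg w hw]
  zero_mem' _ _ := rfl
  neg_mem' hf w hw := by simp [hf w hw]

theorem orderGE_antitone {m n : ℕ} (h : m ≤ n) : orderGE α n ≤ orderGE α m :=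
  fun _ hf w hw => hf w (hw.trans_le h)

/-- The coefficient of the last letter `a`. -/
def lastSlice (a : α) : WordSeries α →+ WordSeries α where
  toFun f w := f (w ++ [a])
  map_zero' := rfl
  map_add' _ _ := rfl

@[simp] theorem lastSlice_apply (a : α) (f : WordSeries α) (w : List α) :
    lastSlice a f w = f (w ++ [a]) := rfl

theorem mem_orderGE_succ_iff {n : ℕ} {f : WordSeries α} :
    f ∈ orderGE α (n + 1) ↔ f [] = 0 ∧ ∀ a, lastSlice a f ∈ orderGE α n := by
  refine ⟨fun h => ⟨h [] (by simp), fun a w hw => h _ (by simpa using hw)⟩, fun h w hw => ?_⟩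
  rcases w.eq_nil_or_concat' with rfl | ⟨u, a, rfl⟩
  · exact h.1
  · exact h.2 a u (by simpa using hw)

theorem freeGroup_induction {C : FreeGroup α → Prop} (one : C 1) (of : ∀ a, C (FreeGroup.of a))
    (inv : ∀ g, C g → C g⁻¹) (mul : ∀ g h, C g → C h → C (g * h)) (g : FreeGroup α) : C g :=
  FreeGroup.induction_on g one of (fun _ => inv _) mul

variable [DecidableEq α]

/-- Left multiplication by the letter `a`. -/
def leftMul (a : α) : WordSeries α →+ WordSeries α where
  toFun f
    | [] => 0
    | b :: w => if b = a then f w else 0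
  map_zero' := by ext (_ | ⟨b, w⟩) <;> simp
  map_add' f g := by ext (_ | ⟨b, w⟩) <;> simp; split_ifs <;> simp

@[simp] theorem leftMul_nil (a : α) (f : WordSeries α) : leftMul a f [] = 0 := rfl
@[simp] theorem leftMul_cons (a b : α) (f : WordSeries α) (w : List α) :
    leftMul a f (b :: w) = if b = a then f w else 0 := rfl

/-- The solution `g` of `g + a * g = f`. -/
def divOneAdd (a : α) (f : WordSeries α) : WordSeries α
  | [] => f []
  | b :: w => f (b :: w) - if b = a then divOneAdd a f w else 0

/-- Left multiplication by `1 + a`. -/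
def mulOneAdd (a : α) : WordSeries α ≃ₗ[ℤ] WordSeries α where
  toFun f := f + leftMul a f
  invFun := divOneAdd a
  left_inv f := by
    ext w
    induction w with
    | nil => simp [divOneAdd]
    | cons b w ih => simp [divOneAdd, ih]
  right_inv f := by
    ext w
    cases w <;> simp [divOneAdd]
  map_add' f g := by simp only [map_add]; abel
  map_smul' n f := by rw [map_zsmul, smul_add]; rfl

theorem mulOneAdd_apply (a : α) (f : WordSeries α) : mulOneAdd a f = f + leftMul a f := rfl

/-- The Magnus representation: a generator `a` acts by left multiplication by `1 + a`. -/
def magnus (α : Type*) [DecidableEq α] : FreeGroup α →* (WordSeries α ≃ₗ[ℤ] WordSeries α) :=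
  FreeGroup.lift mulOneAdd

@[simp] theorem magnus_of (a : α) (f : WordSeries α) :
    magnus α (FreeGroup.of a) f = f + leftMul a f := by
  simp [magnus, mulOneAdd_apply]

theorem magnus_mul (g h : FreeGroup α) (f : WordSeries α) :
    magnus α (g * h) f = magnus α g (magnus α h f) := by simp

theorem magnus_apply_inv (g : FreeGroup α) (f : WordSeries α) :
    magnus α g (magnus α g⁻¹ f) = f := by rw [← magnus_mul]; simp

@[simp] theorem magnus_nil (g : FreeGroup α) : ∀ f : WordSeries α, magnus α g f [] = f [] := by
  induction g using freeGroup_induction with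
  | one => simp
  | of a => simp
  | inv g ih => intro f; rw [← ih (magnus α g⁻¹ f), magnus_apply_inv]
  | mul g h hg hh => intro f; rw [magnus_mul, hg, hh]

/-- Left multiplication does not touch the last letter, except that it can create a one-letter word
from the constant term. Stripping last letters is the induction on degree used below. -/
theorem lastSlice_magnus (a : α) (g : FreeGroup α) : ∀ f : WordSeries α, f [] = 0 →
    lastSlice a (magnus α g f) = magnus α g (lastSlice a f) := by
  induction g using freeGroup_induction with
  | one => simp
  | of b =>
    intro f hf
    ext w
    cases w <;> simp [hf]
  | inv g ih =>
    intro f hf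
    apply (magnus α g).injective
    rw [← ih _ (by rwa [magnus_nil]), magnus_apply_inv, magnus_apply_inv]
  | mul g h hg hh =>
    intro f hf
    rw [magnus_mul, hg _ (by simpa using hf), hh f hf, magnus_mul]

theorem magnus_sub_mem {k : ℕ} (g : FreeGroup α) {f : WordSeries α} (hf : f ∈ orderGE α k) :
    magnus α g f - f ∈ orderGE α (k + 1) := by
  induction k generalizing f with
  | zero => exact mem_orderGE_succ_iff.2 ⟨by simp, fun a w hw => by simp at hw⟩
  | succ k ih =>
    rw [mem_orderGE_succ_iff] at hf
    refine mem_orderGE_succ_iff.2 ⟨by simp, fun a => ?_⟩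
    rw [map_sub, lastSlice_magnus a g f hf.1]
    exact ih (hf.2 a)

theorem magnus_mem {k : ℕ} (g : FreeGroup α) {f : WordSeries α} (hf : f ∈ orderGE α k) :
    magnus α g f ∈ orderGE α k := by
  simpa using add_mem (orderGE_antitone k.le_succ (magnus_sub_mem g hf)) hf

/-! ### Dimension subgroups -/

/-- The `n`-th dimension subgroup: it acts trivially in degrees less than `n`. -/
def dimensionSubgroup (α : Type*) [DecidableEq α] (n : ℕ) : Subgroup (FreeGroup α) where
  carrier := {g | ∀ f, magnus α g f - f ∈ orderGE α n}
  mul_mem' {g h} hg hh f := by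
    rw [magnus_mul]
    simpa using add_mem (hg (magnus α h f)) (hh f)
  one_mem' f := by simp
  inv_mem' {g} hg f := by
    have := hg (magnus α g⁻¹ f)
    rw [magnus_apply_inv] at this
    simpa using neg_mem this

theorem dimensionSubgroup_antitone {m n : ℕ} (h : m ≤ n) :
    dimensionSubgroup α n ≤ dimensionSubgroup α m :=
  fun _ hg f => orderGE_antitone h (hg f)

theorem dimensionSubgroup_one : dimensionSubgroup α 1 = ⊤ :=
  top_unique fun g _ f => magnus_sub_mem g (k := 0) (fun w hw => by simp at hw)

theorem magnus_sub_mem_of_mem {n : ℕ} {g : FreeGroup α} (hg : g ∈ dimensionSubgroup α n)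
    {f : WordSeries α} (hf : f [] = 0) : magnus α g f - f ∈ orderGE α (n + 1) := by
  refine mem_orderGE_succ_iff.2 ⟨by simp, fun a => ?_⟩
  rw [map_sub, lastSlice_magnus a g f hf]
  exact hg _

theorem mem_dimensionSubgroup_iff_one {n : ℕ} {g : FreeGroup α} :
    g ∈ dimensionSubgroup α n ↔ magnus α g one - one ∈ orderGE α n := by
  refine ⟨fun h => h _, fun h => ?_⟩
  induction n with
  | zero => intro f w hw; simp at hw
  | succ n ih =>
    intro f
    have key := magnus_sub_mem_of_mem (ih (orderGE_antitone n.le_succ h)) (f := f - f [] • one)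
      (by simp)
    rw [map_sub, map_zsmul] at key
    have := add_mem key (zsmul_mem h (f []))
    convert this using 1
    rw [smul_sub]
    abel

theorem commutator_dimensionSubgroup_le (n : ℕ) :
    ⁅dimensionSubgroup α n, (⊤ : Subgroup (FreeGroup α))⁆ ≤ dimensionSubgroup α (n + 1) := by
  rw [Subgroup.commutator_le]
  intro z hz g _ f
  -- With f = gzf', the difference to estimate is zgf' - gzf' = (z-1)(g-1)f' - (g-1)(z-1)f', and
  -- each term has order at least n + 1.
  obtain ⟨f, rfl⟩ : ∃ f', magnus α (g * z) f' = f :=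
    ⟨magnus α (g * z)⁻¹ f, magnus_apply_inv _ _⟩
  change magnus α (z * g * z⁻¹ * g⁻¹) _ - _ ∈ _
  rw [← magnus_mul, show z * g * z⁻¹ * g⁻¹ * (g * z) = z * g by group]
  have h1 := magnus_sub_mem_of_mem hz (f := magnus α g f - f) (by simp)
  have h2 := magnus_sub_mem g (hz f)
  rw [magnus_mul, magnus_mul]
  rw [map_sub] at h1 h2
  convert sub_mem h1 h2 using 1
  abel

theorem lowerCentralSeries_le_dimensionSubgroup (n : ℕ) :
    (⊤ : Subgroup (FreeGroup α)).lowerCentralSeries n ≤ dimensionSubgroup α (n + 1) := by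
  induction n with
  | zero => simp [dimensionSubgroup_one]
  | succ n ih =>
    exact (Subgroup.commutator_mono ih le_rfl).trans (commutator_dimensionSubgroup_le _)

/-- In degree `n` an element of the `n`-th dimension subgroup adds its leading term. -/
theorem magnus_apply_of_mem {n : ℕ} {g : FreeGroup α} (hg : g ∈ dimensionSubgroup α n)
    (f : WordSeries α) {w : List α} (hw : w.length ≤ n) :
    magnus α g f w = f w + f [] * (magnus α g one w - one w) := by
  have key := magnus_sub_mem_of_mem hg (f := f - f [] • one) (by simp) w (by omega)
  rw [map_sub, map_zsmul] at key
  simp only [Pi.sub_apply, Pi.smul_apply, smul_eq_mul] at key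
  linarith

theorem magnus_apply_eq_of_mem {n : ℕ} {g : FreeGroup α} (hg : g ∈ dimensionSubgroup α n)
    (f : WordSeries α) {w : List α} (hw : w.length < n) : magnus α g f w = f w :=
  sub_eq_zero.1 (hg f w hw)

/-! ### Faithfulness -/

/-- In (1 + a)^n = 1 + na + ⋯ the higher powers of a cannot contribute to w or aw when w does not
start with a. -/
theorem zpow_mulOneAdd (a : α) (n : ℤ) (f : WordSeries α) (w : List α) (hw : w.head? ≠ some a) :
    (mulOneAdd a ^ n) f w = f w ∧ (mulOneAdd a ^ n) f (a :: w) = f (a :: w) + n * f w := by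
  have step : ∀ f : WordSeries α, mulOneAdd a f w = f w ∧
      mulOneAdd a f (a :: w) = f (a :: w) + f w := by
    intro f
    cases w <;> simp_all [mulOneAdd_apply]
  induction n with
  | zero => simp
  | succ n ih =>
    rw [add_comm, zpow_add, zpow_one, LinearEquiv.mul_apply, (step _).1, (step _).2, ih.1, ih.2]
    exact ⟨rfl, by ring⟩
  | pred n ih =>
    obtain ⟨h1, h2⟩ := step ((mulOneAdd a ^ (-(n : ℤ) - 1)) f)
    rw [← LinearEquiv.mul_apply, ← zpow_one_add, show 1 + (-(n : ℤ) - 1) = -n by ring] at h1 h2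
    rw [ih.1] at h1
    rw [ih.2] at h2
    refine ⟨h1.symm, ?_⟩
    linarith

theorem zpow_mulOneAdd_cons_of_ne (a b : α) (hb : b ≠ a) (n : ℤ) (f : WordSeries α) (w : List α) :
    (mulOneAdd a ^ n) f (b :: w) = f (b :: w) :=
  (zpow_mulOneAdd a n f _ (by simpa using hb)).1

/-- The series whose support among the words without repeated adjacent letters has a unique
longest element, which starts with `i`. -/
def pingPongSet (i : α) : Set (WordSeries α) :=
  {f | ∃ w, (i :: w).IsChain (· ≠ ·) ∧ f (i :: w) ≠ 0 ∧
    ∀ v : List α, v.IsChain (· ≠ ·) → w.length + 1 ≤ v.length → v ≠ i :: w → f v = 0}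

-- Ping-pong for F as a free product of infinite cyclic groups: a nontrivial power (1 + i)^n
-- prepends i to the longest reduced word jw, with coefficient multiplied by n ≠ 0.
open scoped Pointwise in
open scoped Function in
theorem magnus_injective [Nontrivial α] : Function.Injective (magnus α) := by
  have hcomp : magnus α =
      (Monoid.CoprodI.lift fun i => FreeGroup.lift fun _ : Unit => mulOneAdd i).comp
        (@freeGroupEquivCoprodI α).toMonoidHom := by
    ext i
    simp [magnus]
  rw [hcomp, MonoidHom.coe_comp]
  refine Function.Injective.comp ?_ (MulEquiv.injective freeGroupEquivCoprodI)
  apply Monoid.CoprodI.lift_injective_of_ping_pong _ _ (pingPongSet (α := α))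
  · intro i
    refine ⟨fun w => if w = [i] then 1 else 0, [], by simp, by simp, ?_⟩
    intro v _ _ hv
    simp [hv]
  · intro i j hij
    refine Set.disjoint_left.2 ?_
    rintro f ⟨w, hw, hfw, hw'⟩ ⟨v, hv, hfv, hv'⟩
    rcases le_total w.length v.length with h | h
    · exact hfv (hw' _ hv (by simpa using h) (by simp [hij.symm]))
    · exact hfw (hv' _ hw (by simpa using h) (by simp [hij]))
  · intro i j hij
    refine FreeGroup.freeGroupUnitEquivInt.forall_congr_left.mpr ?_
    intro n hn
    have hn0 : n ≠ 0 := by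
      rintro rfl
      exact hn (by simp [FreeGroup.freeGroupUnitEquivInt])
    change FreeGroup.lift (fun _ => mulOneAdd i) (FreeGroup.of () ^ n) • pingPongSet j ⊆ _
    rw [map_zpow, FreeGroup.lift_apply_of]
    rintro _ ⟨f, ⟨w, hw, hfw, hw'⟩, rfl⟩
    change (mulOneAdd i ^ n) f ∈ _
    refine ⟨j :: w, ?_, ?_, ?_⟩
    · exact List.isChain_cons_cons.2 ⟨hij, hw⟩
    · rw [(zpow_mulOneAdd i n f (j :: w) (by simpa using hij.symm)).2,
        hw' _ (List.isChain_cons_cons.2 ⟨hij, hw⟩) (by simp) (by simp), zero_add]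
      exact mul_ne_zero hn0 hfw
    · intro v hv hlen hne
      cases v with
      | nil => simp at hlen
      | cons b v =>
        have hfv : f (b :: v) = 0 := by
          refine hw' _ hv (by simp at hlen ⊢; omega) ?_
          rintro h
          rw [h] at hlen
          simp at hlen
        by_cases hb : b = i
        · subst hb
          rw [(zpow_mulOneAdd b n f v ?_).2, hfv,
            hw' v hv.tail (by simpa using hlen) (by simpa using hne)]
          · simp
          · cases v with
            | nil => simp
            | cons c v => simpa using (List.isChain_cons_cons.1 hv).1.symm
        · rw [zpow_mulOneAdd_cons_of_ne i b hb, hfv]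
  -- The ping-pong lemma also wants a factor with at least three elements; every factor is infinite.
  · right
    obtain ⟨i⟩ : Nonempty α := inferInstance
    refine ⟨i, ?_⟩
    rw [FreeGroup.freeGroupUnitEquivInt.cardinal_eq, Cardinal.mk_denumerable]
    exact Cardinal.natCast_le_aleph0

theorem exists_notMem_dimensionSubgroup [Nontrivial α] {g : FreeGroup α} (hg : g ≠ 1) :
    ∃ n, g ∉ dimensionSubgroup α n := by
  by_contra! h
  refine hg (magnus_injective ?_)
  ext f w
  rw [map_one, ← sub_eq_zero]
  exact h (w.length + 1) f w (by simp)

end WordSeries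

namespace WordSeries

variable {α : Type*}

/-! ### Insertion of a letter -/

/-- The derivation sending the letter `a` to `1` and the other letters to `0`. -/
def letterDeriv (a : α) : WordSeries α →+ WordSeries α where
  toFun f v := ∑ i ∈ Finset.range (v.length + 1), f (v.take i ++ a :: v.drop i)
  map_zero' := by ext; simp
  map_add' f g := by ext; simp [Finset.sum_add_distrib]

theorem letterDeriv_apply (a : α) (f : WordSeries α) (v : List α) :
    letterDeriv a f v = ∑ i ∈ Finset.range (v.length + 1), f (v.take i ++ a :: v.drop i) := rfl

@[simp] theorem letterDeriv_nil (a : α) (f : WordSeries α) : letterDeriv a f [] = f [a] := by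
  simp [letterDeriv_apply]

theorem letterDeriv_cons (a b : α) (f : WordSeries α) (v : List α) :
    letterDeriv a f (b :: v) = f (a :: b :: v) + letterDeriv a (fun w => f (b :: w)) v := by
  rw [letterDeriv_apply, List.length_cons, Finset.sum_range_succ']
  simp [letterDeriv_apply, add_comm]

theorem letterDeriv_one (a : α) : letterDeriv a (one : WordSeries α) = 0 := by
  ext v
  cases v with
  | nil => simp
  | cons b v =>
    rw [letterDeriv_apply]
    exact Finset.sum_eq_zero fun i _ => by cases i <;> simp

variable [DecidableEq α]

/-- The derivation `a ∂/∂a`. -/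
def eulerDeriv (a : α) : WordSeries α →+ WordSeries α where
  toFun f v := v.count a * f v
  map_zero' := by ext; simp
  map_add' f g := by ext; simp [mul_add]

theorem eulerDeriv_apply (a : α) (f : WordSeries α) (v : List α) :
    eulerDeriv a f v = v.count a * f v := rfl

theorem eulerDeriv_one (a : α) : eulerDeriv a (one : WordSeries α) = 0 := by
  ext v
  cases v <;> simp [eulerDeriv_apply]

theorem letterDeriv_leftMul (a b : α) (f : WordSeries α) :
    letterDeriv a (leftMul b f) = (if a = b then f else 0) + leftMul b (letterDeriv a f) := by
  ext v
  cases v with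
  | nil => simp; split_ifs <;> rfl
  | cons c v =>
    rw [letterDeriv_cons]
    simp only [leftMul_cons, Pi.add_apply]
    congr 1
    · split_ifs <;> rfl
    · split_ifs with h
      · rfl
      · rw [letterDeriv_apply]
        exact Finset.sum_const_zero

theorem eulerDeriv_leftMul (a b : α) (f : WordSeries α) :
    eulerDeriv a (leftMul b f) =
      (if a = b then leftMul b f else 0) + leftMul b (eulerDeriv a f) := by
  ext v
  cases v with
  | nil => simp [eulerDeriv_apply]; split_ifs <;> simp
  | cons c v =>
    simp only [eulerDeriv_apply, leftMul_cons, Pi.add_apply, List.count_cons]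
    by_cases hcb : c = b
    · subst hcb
      by_cases hab : a = c
      · subst hab
        simp [add_mul, add_comm]
      · simp [hab, Ne.symm hab]
    · by_cases hab : a = b <;> simp [hcb, hab]

/-- The sum of the two derivations sends a to 1 + a and kills the other letters, so each generator's
image is an eigenvector; e is the exponent sum of a in g. -/
theorem exists_deriv_magnus (a : α) (g : FreeGroup α) : ∃ e : ℤ, ∀ f : WordSeries α,
    (letterDeriv a + eulerDeriv a) (magnus α g f) =
      magnus α g ((letterDeriv a + eulerDeriv a) f) + e • magnus α g f := by
  induction g using freeGroup_induction with
  | one => exact ⟨0, by simp⟩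
  | of b =>
    refine ⟨if a = b then 1 else 0, fun f => ?_⟩
    simp only [magnus_of, map_add, AddMonoidHom.add_apply, letterDeriv_leftMul,
      eulerDeriv_leftMul]
    split_ifs <;> simp <;> abel
  | inv g ih =>
    obtain ⟨e, he⟩ := ih
    refine ⟨-e, fun f => (magnus α g).injective ?_⟩
    have := he (magnus α g⁻¹ f)
    rw [magnus_apply_inv] at this
    rw [map_add, magnus_apply_inv, map_zsmul, magnus_apply_inv, this]
    simp
  | mul g h hg hh =>
    obtain ⟨e, he⟩ := hg
    obtain ⟨e', he'⟩ := hh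
    refine ⟨e + e', fun f => ?_⟩
    rw [magnus_mul, he, he', map_add, map_zsmul, ← magnus_mul, ← magnus_mul, add_smul]
    abel

/-- The leading term of an element of the `n`-th dimension subgroup, `2 ≤ n`, is annihilated by
all derivations `letterDeriv a`. -/
theorem letterDeriv_magnus_one {n : ℕ} (hn : 2 ≤ n) {g : FreeGroup α}
    (hg : g ∈ dimensionSubgroup α n) (a : α) {v : List α} (hv : v.length + 1 = n) :
    letterDeriv a (magnus α g one - one) v = 0 := by
  obtain ⟨e, he⟩ := exists_deriv_magnus a g
  have key := he one
  simp only [AddMonoidHom.add_apply, letterDeriv_one, eulerDeriv_one, add_zero, map_zero,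
    zero_add] at key
  -- Constant terms are compared: the linear coefficients of g vanish because n ≥ 2.
  have he0 : e = 0 := by
    have := congrFun key []
    simp only [Pi.add_apply, letterDeriv_nil, eulerDeriv_apply, Pi.smul_apply, magnus_nil] at this
    rw [magnus_apply_eq_of_mem hg _ (by simp; omega)] at this
    simpa using this.symm
  have := congrFun key v
  simp only [Pi.add_apply, eulerDeriv_apply, he0, zero_smul, Pi.zero_apply] at this
  rw [magnus_apply_eq_of_mem hg _ (by omega)] at this
  obtain ⟨b, v, rfl⟩ := List.exists_cons_of_length_pos (l := v) (by omega)
  rw [map_sub, letterDeriv_one]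
  simpa using this

/-! ### Conjugates of a generator -/

theorem magnus_single_cons (g : FreeGroup α) (a d : α) (u : List α) :
    magnus α g (leftMul a one) (u ++ [d]) = if d = a then magnus α g one u else 0 := by
  have h := congrFun (lastSlice_magnus d g (leftMul a one) (by simp)) u
  rw [lastSlice_apply] at h
  rw [h]
  have : lastSlice d (leftMul a one : WordSeries α) = if d = a then one else 0 := by
    ext v
    rcases v with _ | ⟨b, v⟩
    · simp; split_ifs <;> rfl
    · cases v <;> simp <;> split_ifs <;> rfl
  rw [this]
  split_ifs <;> simp

/-- If `a * z` is conjugate to the generator `a`, then the leading term of `z` is a commutator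
with `a`. -/
theorem magnus_one_of_conj {n : ℕ} {z g : FreeGroup α} (hz : z ∈ dimensionSubgroup α n) {a : α}
    (h : g * FreeGroup.of a = FreeGroup.of a * z * g) (c d : α) {u : List α}
    (hu : u.length + 2 = n) :
    (magnus α z one - one : WordSeries α) (c :: (u ++ [d])) =
      (if d = a then magnus α g one (c :: u) else 0) -
        (if c = a then magnus α g one (u ++ [d]) else 0) := by
  -- Coefficients of the word cud in g(1 + a) = (1 + a)zg: the degree-n part of g cancels, and its
  -- degree n - 1 part survives.
  have key := congrFun (congrArg (fun k => magnus α k one) h) (c :: (u ++ [d]))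
  rw [magnus_mul, magnus_of, map_add, magnus_mul, magnus_mul, magnus_of, Pi.add_apply,
    Pi.add_apply, leftMul_cons, magnus_apply_eq_of_mem hz _ (w := u ++ [d]) (by simp; omega),
    magnus_apply_of_mem hz _ (by simp; omega), magnus_nil, one_nil, one_mul,
    ← List.cons_append, magnus_single_cons] at key
  rw [Pi.sub_apply]
  simp only [List.cons_append] at key ⊢
  linarith

/-! ### Cyclically invariant functions on words -/

-- By cyclicity, each insertion of a into u gives the value of h at a followed by a rotation of u.
-- These values turn out to be constant in the rotation, and hs becomes (k + 2) h(au) = 0.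
omit [DecidableEq α] in
theorem eq_zero_of_cyclic (h : WordSeries α) (k : ℕ) (a : α)
    (hc : ∀ c u, u.length = k → h (c :: u) = h (u ++ [c]))
    (hs : ∀ u : List α, u.length = k → h (a :: u) + letterDeriv a h u = 0)
    (u : List α) (hu : u.length = k) : h (a :: u) = 0 := by
  have hrot : ∀ p q : List α, p.length + q.length = k + 1 → h (p ++ q) = h (q ++ p) := by
    intro p
    induction p with
    | nil => simp
    | cons c p ih =>
      intro q hq
      simp only [List.length_cons] at hq
      rw [List.cons_append, hc c _ (by simp; omega), List.append_assoc, ih _ (by simp; omega),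
        List.append_assoc]
      rfl
  let f : ℕ → ℤ := fun j => h (a :: u.rotate j)
  have hper : ∀ j, f (j + k) = f j := by
    intro j
    simp only [f]
    rw [add_comm, ← List.rotate_rotate, ← hu, List.rotate_length]
  have hsum : ∀ j, f j + (∑ i ∈ Finset.range k, f (j + i)) + f j = 0 := by
    intro j
    have := hs (u.rotate j) (by simpa using hu)
    rw [letterDeriv_apply, List.length_rotate, hu] at this
    rw [← this, add_assoc, ← hper j, ← Finset.sum_range_succ (fun i => f (j + i)), hper j]
    congr 1
    refine Finset.sum_congr rfl fun i hi => ?_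
    have hi : i ≤ k := by simpa [Nat.lt_succ_iff] using hi
    rw [hrot _ _ (by simp; omega), List.cons_append,
      ← List.rotate_eq_drop_append_take (by simp; omega), List.rotate_rotate]
  -- By periodicity, sums over k consecutive values agree, so subtracting the relations at j and j +
  -- 1 leaves 2(f(j+1) - f(j)) = 0.
  have hstep : ∀ j, f (j + 1) = f j := by
    intro j
    have h1 := hsum j
    have h2 := hsum (j + 1)
    have h3 := Finset.sum_range_succ (fun i => f (j + i)) k
    rw [Finset.sum_range_succ', hper] at h3
    simp only [add_right_comm j, ← add_assoc, add_zero] at h2 h3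
    linarith
  have hconst : ∀ j, f j = f 0 := by
    intro j
    induction j with
    | zero => rfl
    | succ j ih => rw [hstep, ih]
  have h0 := hsum 0
  simp only [hconst, Finset.sum_const, Finset.card_range, nsmul_eq_mul] at h0
  have : ((k : ℤ) + 2) * f 0 = 0 := by linarith
  have : f 0 = 0 := by
    rcases mul_eq_zero.1 this with h | h
    · omega
    · exact h
  simpa [f] using this

/-! ### The substitution of `xy` for `x` -/

/-- The coefficient of the first letter `a`. -/
def headSlice (a : α) : WordSeries α →+ WordSeries α where
  toFun f w := f (a :: w)
  map_zero' := rfl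
  map_add' _ _ := rfl

omit [DecidableEq α] in
@[simp] theorem headSlice_apply (a : α) (f : WordSeries α) (w : List α) :
    headSlice a f w = f (a :: w) := rfl

theorem headSlice_leftMul (a b : α) (f : WordSeries α) :
    headSlice a (leftMul b f) = if a = b then f else 0 := by
  ext w
  simp only [headSlice_apply, leftMul_cons]
  split_ifs <;> rfl

/-- The coefficients of the series obtained by substituting `X + Y + XY` for the letter
`X = true`, where `Y = false`. -/
def substCoeff : List Bool → WordSeries Bool →+ ℤ
  | [] => Pi.evalAddMonoidHom _ []
  | false :: w => (substCoeff w).comp (headSlice true + headSlice false)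
  | [true] => (substCoeff []).comp (headSlice true)
  | true :: true :: w => (substCoeff (true :: w)).comp (headSlice true)
  -- An initial XY comes either from the summand X, with Y produced by the next letter, or from the
  -- summand XY.
  | true :: false :: w => (substCoeff (false :: w) + substCoeff w).comp (headSlice true)

/-- Substitution of `X + Y + XY` for the letter `X = true`, where `Y = false`. -/
def subst : WordSeries Bool →+ WordSeries Bool where
  toFun f w := substCoeff w f
  map_zero' := by ext; simp
  map_add' f g := by ext; simp

@[simp] theorem subst_nil (f : WordSeries Bool) : subst f [] = f [] := by
  simp [subst, substCoeff]

theorem subst_false (f : WordSeries Bool) (w : List Bool) :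
    subst f (false :: w) = subst (headSlice true f) w + subst (headSlice false f) w := by
  simp [subst, substCoeff]

theorem subst_true (f : WordSeries Bool) (w : List Bool) : subst f (true :: w) =
    subst (headSlice true f) w + leftMul false (subst (headSlice true f)) w := by
  rcases w with _ | ⟨_ | _, w⟩ <;> simp [subst, substCoeff]

theorem subst_one : subst one = one := by
  have (a : Bool) : headSlice a (one : WordSeries Bool) = 0 := rfl
  ext w
  rcases w with _ | ⟨_ | _, w⟩
  · simp
  · simp [subst_false, this]
  · rw [subst_true, this]
    simp

theorem subst_leftMul_true (f : WordSeries Bool) : subst (leftMul true f) =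
    leftMul true (subst f) + leftMul false (subst f) + leftMul true (leftMul false (subst f)) := by
  ext w
  rcases w with _ | ⟨_ | _, w⟩
  · simp
  · simp [subst_false, headSlice_leftMul]
  · simp [subst_true, headSlice_leftMul]

theorem subst_leftMul_false (f : WordSeries Bool) :
    subst (leftMul false f) = leftMul false (subst f) := by
  ext w
  rcases w with _ | ⟨_ | _, w⟩
  · simp
  · simp [subst_false, headSlice_leftMul]
  · simp [subst_true, headSlice_leftMul]

/-- The endomorphism `x ↦ xy`, `y ↦ y` of the free group on `x = true` and `y = false`. -/
def transvection : FreeGroup Bool →* FreeGroup Bool :=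
  FreeGroup.lift fun a => if a then FreeGroup.of true * FreeGroup.of false else FreeGroup.of false

/-- Holds on generators because (1 + X)(1 + Y) = 1 + X + Y + XY. -/
theorem subst_magnus (g : FreeGroup Bool) : ∀ f : WordSeries Bool,
    subst (magnus Bool g f) = magnus Bool (transvection g) (subst f) := by
  induction g using freeGroup_induction with
  | one => simp
  | of b =>
    intro f
    cases b
    · simp [transvection, subst_leftMul_false]
    · simp [transvection, subst_leftMul_true]
      abel
  | inv g ih =>
    intro f
    apply (magnus Bool (transvection g)).injective
    rw [← ih, magnus_apply_inv, map_inv, magnus_apply_inv]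
  | mul g h hg hh =>
    intro f
    rw [magnus_mul, hg, hh, map_mul, magnus_mul]

/-- The coefficients of the series obtained by substituting `X + Y` for the letter `X = true`,
where `Y = false`. -/
def linSubst : List Bool → WordSeries Bool → ℤ
  | [], f => f []
  | false :: w, f => linSubst w (headSlice true f + headSlice false f)
  | true :: w, f => linSubst w (headSlice true f)

theorem headSlice_mem_orderGE {n : ℕ} {f : WordSeries Bool} (hf : f ∈ orderGE Bool (n + 1))
    (a : Bool) : headSlice a f ∈ orderGE Bool n :=
  fun w hw => hf _ (by simpa using hw)

theorem subst_mem_orderGE {n : ℕ} {f : WordSeries Bool} (hf : f ∈ orderGE Bool n) :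
    subst f ∈ orderGE Bool n := by
  intro w
  induction hk : w.length using Nat.strong_induction_on generalizing w n f with
  | _ k ih =>
    subst hk
    intro hw
    obtain ⟨n, rfl⟩ : ∃ k, n = k + 1 := ⟨n - 1, by omega⟩
    have h (b : Bool) := headSlice_mem_orderGE hf b
    rcases w with _ | ⟨a, w⟩
    · simpa using hf [] hw
    · have hw : w.length < n := by simpa using hw
      have h0 (b : Bool) : subst (headSlice b f) w = 0 := ih _ (by simp) (h b) w rfl hw
      cases a
      · rw [subst_false, h0, h0, add_zero]
      · rw [subst_true, h0, zero_add]
        rcases w with _ | ⟨c, w⟩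
        · simp
        · rw [leftMul_cons, ih _ (by simp) (h true) w rfl (by simp at hw; omega), ite_self]

/-- The summand XY raises the degree, so it does not affect the lowest term. -/
theorem subst_eq_linSubst {n : ℕ} {f : WordSeries Bool} (hf : f ∈ orderGE Bool n) {w : List Bool}
    (hw : w.length = n) : subst f w = linSubst w f := by
  induction w generalizing n f with
  | nil => simp [linSubst]
  | cons a w ih =>
    obtain ⟨n, rfl⟩ : ∃ k, n = k + 1 := ⟨n - 1, by simp at hw; omega⟩
    replace hw : w.length = n := by simpa using hw
    have h (b : Bool) := headSlice_mem_orderGE hf b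
    cases a
    · rw [subst_false, linSubst, ← ih (add_mem (h _) (h _)) hw, map_add]
      rfl
    · rw [subst_true, linSubst, ← ih (h _) hw, add_eq_left]
      rcases w with _ | ⟨c, w⟩
      · simp
      · rw [leftMul_cons, subst_mem_orderGE (h true) w (by simp at hw; omega), ite_self]

theorem linSubst_append_false (f : WordSeries Bool) (w : List Bool) :
    linSubst (w ++ [false]) f = linSubst w (lastSlice true f + lastSlice false f) := by
  induction w generalizing f with
  | nil => rfl
  | cons a w ih =>
    cases a
    · simp only [List.cons_append, linSubst, ih]
      congr 1
      ext v
      simp only [Pi.add_apply, headSlice_apply, lastSlice_apply, List.cons_append]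
      ring
    · simp only [List.cons_append, linSubst, ih]
      rfl

theorem linSubst_add (w : List Bool) (f g : WordSeries Bool) :
    linSubst w (f + g) = linSubst w f + linSubst w g := by
  induction w generalizing f g with
  | nil => rfl
  | cons a w ih =>
    cases a
    · simp only [linSubst, map_add, ih]
      ring
    · simp only [linSubst, map_add, ih]

/-- The substitution X ↦ X + Y is triangular, hence injective. -/
theorem eq_zero_of_linSubst (k : ℕ) (f : WordSeries Bool)
    (h : ∀ u : List Bool, u.length = k → linSubst u f = 0) (u : List Bool) (hu : u.length = k) :
    f u = 0 := by
  induction u generalizing k f with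
  | nil => exact h [] hu
  | cons a u ih =>
    obtain ⟨k, rfl⟩ : ∃ j, k = j + 1 := ⟨k - 1, by simp at hu; omega⟩
    have h1 : ∀ v : List Bool, v.length = k → linSubst v (headSlice true f) = 0 :=
      fun v hv => h (true :: v) (by simpa using hv)
    have h2 : ∀ v : List Bool, v.length = k → linSubst v (headSlice false f) = 0 := by
      intro v hv
      have := h (false :: v) (by simpa using hv)
      rwa [linSubst, linSubst_add, h1 v hv, zero_add] at this
    cases a
    · exact ih k _ h2 (by simpa using hu)
    · exact ih k _ h1 (by simpa using hu)

/-! ### Leading terms that are commutators with every primitive element -/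

/-- A homogeneous series of degree at least `3` on two letters vanishes if it is a commutator with
each letter, antisymmetric in its first and last letters, and annihilated by `letterDeriv`. -/
theorem eq_zero_of_commutators {n : ℕ} (hn : 3 ≤ n) (f : WordSeries Bool)
    (hcomm : ∀ a, ∃ ω : WordSeries Bool, ∀ c d u, u.length + 2 = n → f (c :: (u ++ [d])) =
      (if d = a then ω (c :: u) else 0) - (if c = a then ω (u ++ [d]) else 0))
    (hanti : ∀ u : List Bool, u.length + 2 = n → f (true :: (u ++ [true])) +
      f (true :: (u ++ [false])) + f (false :: (u ++ [true])) + f (false :: (u ++ [false])) = 0)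
    (hder : ∀ a, ∀ v : List Bool, v.length + 1 = n → letterDeriv a f v = 0)
    (w : List Bool) (hw : w.length = n) : f w = 0 := by
  -- A commutator with the other letter has no word that both starts and ends with a.
  have hsame : ∀ a u, u.length + 2 = n → f (a :: (u ++ [a])) = 0 := by
    intro a u hu
    obtain ⟨ω, hω⟩ := hcomm (!a)
    rw [hω a a u hu]
    cases a <;> simp
  have hdiff : ∀ a u, u.length + 2 = n → f (a :: (u ++ [!a])) = - f ((!a) :: (u ++ [a])) := by
    intro a u hu
    have := hanti u hu
    rw [hsame _ u hu, hsame _ u hu] at this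
    cases a <;> simp <;> linarith
  -- Both sides equal the same coefficient of ω, one directly and one after exchanging the end
  -- letters.
  have hcyc : ∀ a u, u.length + 3 = n →
      f (a :: ((!a) :: u ++ [!a])) = f (a :: (u ++ [!a] ++ [!a])) := by
    intro a u hu
    obtain ⟨ω, hω⟩ := hcomm a
    rw [hω a (!a) ((!a) :: u) (by simp; omega), hdiff a (u ++ [!a]) (by simp; omega),
      hω (!a) a (u ++ [!a]) (by simp; omega)]
    simp
  have hzero : ∀ a b u, u.length + 3 = n → f (a :: (b :: u ++ [!a])) = 0 := by
    have hcyc' : ∀ a c u, u.length + 3 = n →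
        f (a :: (c :: u ++ [!a])) = f (a :: (u ++ [c] ++ [!a])) := by
      intro a c u hu
      by_cases hc : c = !a
      · rw [hc, hcyc a u hu]
      · obtain rfl : c = a := by cases a <;> cases c <;> simp_all
        rw [hdiff _ _ (by simp; omega), hdiff _ _ (by simp; omega)]
        have := hcyc (!c) u hu
        rw [Bool.not_not] at this
        rw [this]
    -- The coefficient h(v) of a·v·(!a) is cyclic in v. Inserting a into av(!a) gives the relation
    -- for h, since insertion at the far end yields a word starting and ending with a.
    have hfirst : ∀ a u, u.length + 3 = n → f (a :: (a :: u ++ [!a])) = 0 := by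
      intro a u hu
      refine eq_zero_of_cyclic (headSlice a (lastSlice (!a) f)) u.length a ?_ ?_ u rfl
      · intro c v hv
        exact hcyc' a c v (by omega)
      · intro v hv
        have := hder a (a :: v ++ [!a]) (by simp; omega)
        rw [List.cons_append, letterDeriv_cons, letterDeriv_apply, List.length_append,
          List.length_singleton, Finset.sum_range_succ] at this
        rw [List.take_of_length_le (by simp), List.drop_of_length_le (by simp),
          hsame _ _ (by simp; omega), add_zero] at this
        rw [← this]
        congr 1
        rw [letterDeriv_apply]
        refine Finset.sum_congr rfl fun i hi => ?_
        have hi : i ≤ v.length := by simpa [Nat.lt_succ_iff] using hi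
        rw [List.take_append_of_le_length hi, List.drop_append_of_le_length hi]
        simp
    intro a b u hu
    by_cases hb : b = a
    · rw [hb, hfirst a u hu]
    · obtain rfl : a = !b := by cases a <;> cases b <;> simp_all
      rw [hdiff _ _ (by simp; omega), Bool.not_not, hfirst b u hu, neg_zero]
  obtain ⟨c, w, rfl⟩ := List.exists_cons_of_length_pos (l := w) (by omega)
  rcases w.eq_nil_or_concat' with rfl | ⟨u, d, rfl⟩
  · simp at hw; omega
  · simp only [List.length_cons, List.length_append, List.length_nil] at hw
    by_cases hcd : d = c
    · rw [hcd, hsame c u (by omega)]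
    · obtain rfl : d = !c := by cases c <;> cases d <;> simp_all
      obtain ⟨b, u, rfl⟩ := List.exists_cons_of_length_pos (l := u) (by omega)
      exact hzero c b u (by simp at hw; omega)

end WordSeries

open scoped commutatorElement

/-! ### Iterated lower central series -/

section IteratedLowerCentral

variable {G H : Type*} [Group G] [Group H]

theorem foldl_lowerCentralSeries_le (c : List ℕ) (S : Subgroup G) :
    c.foldl (fun H n => H.lowerCentralSeries n) S ≤ S := by
  induction c generalizing S with
  | nil => exact le_rfl
  | cons n c ih => exact (ih _).trans (S.lowerCentralSeries_le_self n)

theorem foldl_lowerCentralSeries_mono (c : List ℕ) {S T : Subgroup G} (h : S ≤ T) :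
    c.foldl (fun H n => H.lowerCentralSeries n) S ≤
      c.foldl (fun H n => H.lowerCentralSeries n) T := by
  induction c generalizing S T with
  | nil => exact h
  | cons n c ih => exact ih (Subgroup.lowerCentralSeries_mono n h)

theorem map_foldl_lowerCentralSeries (f : G →* H) (c : List ℕ) (S : Subgroup G) :
    (c.foldl (fun H n => H.lowerCentralSeries n) S).map f =
      c.foldl (fun H n => H.lowerCentralSeries n) (S.map f) := by
  induction c generalizing S with
  | nil => rfl
  | cons n c ih => rw [List.foldl_cons, ih, Subgroup.map_lowerCentralSeries, List.foldl_cons]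

theorem map_iteratedLowerCentral_le (f : G →* H) (c : List ℕ) :
    (iteratedLowerCentral G c).map f ≤ iteratedLowerCentral H c := by
  rw [iteratedLowerCentral, map_foldl_lowerCentralSeries]
  exact foldl_lowerCentralSeries_mono c le_top

theorem commutator_iteratedLowerCentral_le_comap (f : G →* H) (c : List ℕ) :
    ⁅iteratedLowerCentral G c, (⊤ : Subgroup G)⁆ ≤
      Subgroup.comap f ⁅iteratedLowerCentral H c, (⊤ : Subgroup H)⁆ := by
  rw [← Subgroup.map_le_iff_le_comap, Subgroup.map_commutator]
  exact Subgroup.commutator_mono (map_iteratedLowerCentral_le f c) le_top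

theorem derivedSeries_add_le_lowerCentralSeries {S : Subgroup G} {k : ℕ}
    (h : derivedSeries G k ≤ S) (n : ℕ) : derivedSeries G (k + n) ≤ S.lowerCentralSeries n := by
  induction n with
  | zero => exact h
  | succ n ih =>
    exact Subgroup.commutator_mono ih ((derivedSeries_antitone G (Nat.le_add_right k n)).trans h)

theorem exists_derivedSeries_le_foldl (c : List ℕ) (S : Subgroup G)
    (h : ∃ k, derivedSeries G k ≤ S) :
    ∃ k, derivedSeries G k ≤ c.foldl (fun H n => H.lowerCentralSeries n) S := by
  induction c generalizing S with
  | nil => exact h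
  | cons n c ih =>
    obtain ⟨k, hk⟩ := h
    exact ih _ ⟨k + n, derivedSeries_add_le_lowerCentralSeries hk n⟩

theorem isSolvable_of_iteratedLowerCentral_eq_bot (c : List ℕ)
    (h : iteratedLowerCentral G c = ⊥) : Group.IsSolvable G := by
  obtain ⟨k, hk⟩ := exists_derivedSeries_le_foldl c (⊤ : Subgroup G) ⟨0, le_top⟩
  exact ⟨k, le_bot_iff.1 (h ▸ hk)⟩

/-- Either c₁ ≥ 2, or there is a second step, which lands in [γ₂, γ₂] ≤ γ₃. -/
theorem iteratedLowerCentral_le {c : List ℕ} (hc : c ≠ []) (hpos : ∀ n ∈ c, 1 ≤ n)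
    (h1 : c ≠ [1]) : iteratedLowerCentral G c ≤ (⊤ : Subgroup G).lowerCentralSeries 2 := by
  obtain ⟨n, c, rfl⟩ := List.exists_cons_of_ne_nil hc
  have hn : 1 ≤ n := hpos n (by simp)
  rw [iteratedLowerCentral, List.foldl_cons]
  rcases hn.lt_or_eq with hn | rfl
  · exact (foldl_lowerCentralSeries_le c _).trans (Subgroup.lowerCentralSeries_antitone _ hn)
  · obtain ⟨m, c, rfl⟩ := List.exists_cons_of_ne_nil (l := c) (by simpa using h1)
    have hm : 1 ≤ m := hpos m (by simp)
    rw [List.foldl_cons]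
    exact (foldl_lowerCentralSeries_le c _).trans
      ((Subgroup.lowerCentralSeries_antitone _ hm).trans (Subgroup.commutator_mono le_rfl le_top))

end IteratedLowerCentral

/-- The symmetric group on five points is generated by a 5-cycle and a transposition, and is not
solvable. -/
theorem not_isSolvable_freeGroup_bool : ¬ Group.IsSolvable (FreeGroup Bool) := by
  intro h
  let σ : Equiv.Perm (Fin 5) := finRotate 5
  let f : FreeGroup Bool →* Equiv.Perm (Fin 5) :=
    FreeGroup.lift fun b => if b then σ else Equiv.swap 0 (σ 0)
  have hf : Function.Surjective f := by
    rw [← MonoidHom.range_eq_top, eq_top_iff,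
      ← Equiv.Perm.closure_cycle_adjacent_swap (σ := σ) isCycle_finRotate support_finRotate 0,
      Subgroup.closure_le]
    rintro _ (rfl | rfl)
    · exact ⟨FreeGroup.of true, by simp [f]⟩
    · exact ⟨FreeGroup.of false, by simp [f]⟩
  exact Equiv.Perm.not_isSolvable_fin_5 (Group.isSolvable_of_surjective hf)

/-! ### Normal closures -/

section NormalClosure

variable {G H : Type*} [Group G] [Group H]

theorem commutator_le_of_closure {S : Set G} (hS : Subgroup.closure S = ⊤) {K : Subgroup G}
    [K.Normal] (h : ∀ x ∈ S, ∀ y ∈ S, ⁅x, y⁆ ∈ K) : commutator G ≤ K := by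
  have key : ∀ x y, ⁅x, y⁆ ∈ K ↔ Commute (QuotientGroup.mk' K x) (QuotientGroup.mk' K y) := by
    intro x y
    rw [← commutatorElement_eq_one_iff_commute, ← map_commutatorElement,
      ← MonoidHom.mem_ker, QuotientGroup.ker_mk']
  simp only [key] at h
  rw [commutator_def, Subgroup.commutator_le, ← hS]
  intro g hg k hk
  rw [key]
  induction hg, hk using Subgroup.closure_induction₂ with
  | mem x y hx hy => exact h x hx y hy
  | one_left => simp
  | one_right => simp
  | mul_left x y z _ _ _ hx hy => rw [map_mul]; exact hx.mul_left hy
  | mul_right x y z _ _ _ hx hy => rw [map_mul]; exact hx.mul_right hy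
  | inv_left x y _ _ hx => rw [map_inv]; exact hx.inv_left
  | inv_right x y _ _ hx => rw [map_inv]; exact hx.inv_right

/-- In a group generated by `x` and `y`, a central element of the derived subgroup does not change
the normal closure of `x`. -/
theorem normalClosure_mul_of_mem_center {x y z : G} (hxy : Subgroup.closure {x, y} = ⊤)
    (hz : z ∈ Subgroup.center G) (hz' : z ∈ commutator G) :
    Subgroup.normalClosure {x} = Subgroup.normalClosure {x * z} := by
  -- In a two-generator group the derived subgroup is the normal closure of [x,y]; and [xz,y] =
  -- [x,y] as z is central.
  have aux : ∀ K : Subgroup G, K.Normal → ⁅x, y⁆ ∈ K → z ∈ K := by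
    intro K _ h
    refine commutator_le_of_closure hxy ?_ hz'
    rintro _ (rfl | rfl) _ (rfl | rfl)
    · simp
    · exact h
    · rw [← commutatorElement_inv]
      exact inv_mem h
    · simp
  refine le_antisymm ?_ ?_ <;> refine Subgroup.normalClosure_le_normal ?_ <;>
    rw [Set.singleton_subset_iff, SetLike.mem_coe]
  · have hx := Subgroup.subset_normalClosure (Set.mem_singleton (x * z))
    have hc : ⁅x * z, y⁆ = ⁅x, y⁆ := by
      have h1 := Subgroup.mem_center_iff.1 hz
      rw [commutatorElement_def, commutatorElement_def, mul_inv_rev, mul_assoc x z y, ← h1 y,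
        ← mul_assoc (x * (y * z)), mul_assoc x, mul_assoc y, mul_inv_cancel, mul_one]
    have : z ∈ Subgroup.normalClosure {x * z} := by
      refine aux _ inferInstance ?_
      rw [← hc]
      exact Subgroup.commutator_le_left _ _ (Subgroup.commutator_mem_commutator hx
        (Subgroup.mem_top y))
    simpa using mul_mem hx (inv_mem this)
  · have hx := Subgroup.subset_normalClosure (Set.mem_singleton x)
    refine mul_mem hx (aux _ inferInstance ?_)
    exact Subgroup.commutator_le_left _ _ (Subgroup.commutator_mem_commutator hx
      (Subgroup.mem_top y))

/-- The section s preserves equality of normal closures, and r carries the resulting conjugacy back.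
-/
theorem MagnusProperty.of_retract (hG : MagnusProperty G) (s : H →* G) (r : G →* H)
    (h : ∀ x, r (s x) = x) : MagnusProperty H := by
  have hs : ∀ x y : H, Subgroup.normalClosure {x} ≤ Subgroup.normalClosure {y} →
      Subgroup.normalClosure {s x} ≤ Subgroup.normalClosure {s y} := by
    intro x y hxy
    refine Subgroup.normalClosure_le_normal ?_
    rw [Set.singleton_subset_iff, SetLike.mem_coe, ← Subgroup.mem_comap]
    refine hxy.trans (Subgroup.normalClosure_le_normal ?_)
      (Subgroup.subset_normalClosure (Set.mem_singleton x))
    rw [Set.singleton_subset_iff, SetLike.mem_coe, Subgroup.mem_comap]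
    exact Subgroup.subset_normalClosure (Set.mem_singleton _)
  intro x y hxy
  have := hG (s x) (s y) (le_antisymm (hs x y hxy.le) (hs y x hxy.ge))
  refine this.imp (fun h' => ?_) (fun h' => ?_)
  · simpa [h] using r.map_isConj h'
  · simpa [h] using r.map_isConj h'

theorem MagnusProperty.congr (e : G ≃* H) : MagnusProperty G ↔ MagnusProperty H :=
  ⟨fun h => h.of_retract e.symm.toMonoidHom e.toMonoidHom (by simp),
    fun h => h.of_retract e.toMonoidHom e.symm.toMonoidHom (by simp)⟩

end NormalClosure

/-! ### Failure of the Magnus property -/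

section Failure

open WordSeries

theorem closure_of_pair (a : Bool) :
    Subgroup.closure {FreeGroup.of a, FreeGroup.of (!a)} = (⊤ : Subgroup (FreeGroup Bool)) := by
  rw [← FreeGroup.closure_range_of]
  congr 1
  ext g
  cases a <;> simp [or_comm]

variable {N : Subgroup (FreeGroup Bool)} [N.Normal]

theorem MagnusProperty.exists_conj (hM : MagnusProperty (FreeGroup Bool ⧸ ⁅N, (⊤ : Subgroup _)⁆))
    (hN : N ≤ commutator (FreeGroup Bool)) {z : FreeGroup Bool} (hz : z ∈ N) (a : Bool) :
    ∃ t ∈ ⁅N, (⊤ : Subgroup (FreeGroup Bool))⁆, ∃ g,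
      g * FreeGroup.of a = FreeGroup.of a * (z * t) * g := by
  let q := QuotientGroup.mk' ⁅N, (⊤ : Subgroup (FreeGroup Bool))⁆
  have hq : Function.Surjective q := QuotientGroup.mk'_surjective _
  have hker : ∀ g, q g = 1 ↔ g ∈ ⁅N, (⊤ : Subgroup (FreeGroup Bool))⁆ := fun g => by
    rw [← MonoidHom.mem_ker, QuotientGroup.ker_mk']
  have hcl : Subgroup.closure {q (FreeGroup.of a), q (FreeGroup.of (!a))} = ⊤ := by
    rw [← Set.image_pair, ← MonoidHom.map_closure, closure_of_pair,
      Subgroup.map_top_of_surjective q hq]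
  have hcenter : q z ∈ Subgroup.center _ := by
    rw [Subgroup.mem_center_iff]
    intro g
    obtain ⟨g, rfl⟩ := hq g
    have : ⁅q z, q g⁆ = 1 := by
      rw [← map_commutatorElement, hker]
      exact Subgroup.commutator_mem_commutator hz (Subgroup.mem_top g)
    exact (commutatorElement_eq_one_iff_mul_comm.1 this).symm
  have hcomm : q z ∈ commutator _ := by
    rw [commutator_def, ← Subgroup.map_top_of_surjective q hq, ← Subgroup.map_commutator]
    exact Subgroup.mem_map_of_mem q (hN hz)
  rcases hM _ _ (normalClosure_mul_of_mem_center hcl hcenter hcomm) with h | h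
  · obtain ⟨g, hg⟩ := isConj_iff.1 h
    obtain ⟨g, rfl⟩ := hq g
    refine ⟨(FreeGroup.of a * z)⁻¹ * (g * FreeGroup.of a * g⁻¹), ?_, g, by group⟩
    rw [← hker]
    simp only [map_mul, map_inv, hg]
    group
  · exfalso
    obtain ⟨g, hg⟩ := isConj_iff.1 h
    obtain ⟨g, rfl⟩ := hq g
    -- Conjugacy to the inverse is excluded by the total exponent, which would be 2 on an element of
    -- N ≤ F'.
    let e : FreeGroup Bool →* Multiplicative ℤ := FreeGroup.lift fun _ => Multiplicative.ofAdd 1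
    have he : ∀ w ∈ N, e w = 1 := fun w hw => Abelianization.commutator_subset_ker e (hN hw)
    have hmem : FreeGroup.of a * z * (g * FreeGroup.of a * g⁻¹) ∈ N := by
      refine Subgroup.commutator_le_left N ⊤ ?_
      rw [← hker]
      simp only [map_mul, map_inv] at hg ⊢
      rw [hg]
      group
    have h1 := he _ hmem
    rw [map_mul, map_mul, map_mul, map_mul, map_inv, he z hz, mul_one,
      mul_inv_cancel_comm] at h1
    simp only [e, FreeGroup.lift_apply_of] at h1
    exact absurd h1 (by decide)

omit [N.Normal] in
theorem exists_le_dimensionSubgroup (hN : N ≤ (⊤ : Subgroup (FreeGroup Bool)).lowerCentralSeries 2)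
    (h1 : N ≠ ⊥) : ∃ n, 3 ≤ n ∧ N ≤ dimensionSubgroup Bool n ∧
      ¬ N ≤ dimensionSubgroup Bool (n + 1) := by
  classical
  obtain ⟨⟨z, hz⟩, hz1⟩ := N.ne_bot_iff_exists_ne_one.1 h1
  have hex : ∃ n, ¬ N ≤ dimensionSubgroup Bool n := by
    obtain ⟨n, hn⟩ := exists_notMem_dimensionSubgroup (g := z) (by simpa using hz1)
    exact ⟨n, fun h => hn (h hz)⟩
  have h3 : N ≤ dimensionSubgroup Bool 3 := hN.trans (lowerCentralSeries_le_dimensionSubgroup 2)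
  have hlt : 3 < Nat.find hex := by
    by_contra! h
    exact Nat.find_spec hex (h3.trans (dimensionSubgroup_antitone h))
  obtain ⟨n, hn⟩ : ∃ n, Nat.find hex = n + 1 := ⟨Nat.find hex - 1, by omega⟩
  refine ⟨n, by omega, ?_, hn ▸ Nat.find_spec hex⟩
  exact not_not.1 (Nat.find_min hex (m := n) (by omega))

-- Otherwise N ≤ γ₃(F) ≤ [N,F], and commutation with F would push N one dimension subgroup deeper.
omit [N.Normal] in
theorem not_lowerCentralSeries_two_le
    (hN : N ≤ (⊤ : Subgroup (FreeGroup Bool)).lowerCentralSeries 2) (h1 : N ≠ ⊥) :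
    ¬ (⊤ : Subgroup (FreeGroup Bool)).lowerCentralSeries 2 ≤
      ⁅N, (⊤ : Subgroup (FreeGroup Bool))⁆ := by
  intro h
  obtain ⟨n, -, hn, hn'⟩ := exists_le_dimensionSubgroup hN h1
  exact hn' (hN.trans (h.trans ((Subgroup.commutator_mono hn le_rfl).trans
    (commutator_dimensionSubgroup_le n))))

theorem not_magnusProperty (hN : N ≤ (⊤ : Subgroup (FreeGroup Bool)).lowerCentralSeries 2)
    (h1 : N ≠ ⊥) (hT : ∀ z ∈ N, transvection z ∈ N) :
    ¬ MagnusProperty (FreeGroup Bool ⧸ ⁅N, (⊤ : Subgroup (FreeGroup Bool))⁆) := by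
  intro hM
  obtain ⟨n, hn3, hn, hn'⟩ := exists_le_dimensionSubgroup hN h1
  have hNc : N ≤ commutator (FreeGroup Bool) := by
    rw [← Subgroup.top_lowerCentralSeries_one]
    exact hN.trans (Subgroup.lowerCentralSeries_antitone _ one_le_two)
  have hconj : ∀ z ∈ N, ∀ a, ∃ ω : WordSeries Bool, ∀ c d u, u.length + 2 = n →
      (magnus Bool z one - one : WordSeries Bool) (c :: (u ++ [d])) =
        (if d = a then ω (c :: u) else 0) - (if c = a then ω (u ++ [d]) else 0) := by
    intro z hz a
    obtain ⟨t, ht, g, hg⟩ := hM.exists_conj hNc hz a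
    refine ⟨magnus Bool g one, fun c d u hu => ?_⟩
    have htN : t ∈ N := Subgroup.commutator_le_left N ⊤ ht
    -- The correction t has order at least n + 1, so zt and z share their degree-n term.
    have htD := commutator_dimensionSubgroup_le n (Subgroup.commutator_mono hn le_rfl ht)
    rw [← magnus_one_of_conj (hn (mul_mem hz htN)) hg c d hu, Pi.sub_apply, Pi.sub_apply,
      magnus_mul, sub_left_inj, eq_comm, ← sub_eq_zero, ← Pi.sub_apply, ← map_sub]
    exact magnus_mem z (htD one) _ (by simp; omega)
  refine hn' fun z hz => mem_dimensionSubgroup_iff_one.2 fun w hw => ?_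
  have hz' := mem_dimensionSubgroup_iff_one.1 (hn hz)
  rcases (Nat.lt_succ_iff.1 hw).lt_or_eq with hw | hw
  · exact hz' w hw
  refine eq_zero_of_commutators hn3 _ (hconj z hz) ?_
    (fun a v hv => letterDeriv_magnus_one (by omega) (hn hz) a hv) w hw
  obtain ⟨ω, hω⟩ := hconj _ (hT z hz) true
  have hsub : magnus Bool (transvection z) one - one = subst (magnus Bool z one - one) := by
    rw [map_sub, subst_magnus, subst_one]
  rw [hsub] at hω
  intro u hu
  -- The transformed term is a commutator with X, so its coefficients at words YvY vanish. Undoing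
  -- the substitution in the middle letters gives the four-term relation.
  have := eq_zero_of_linSubst u.length
    (lastSlice true (headSlice true (magnus Bool z one - one) +
      headSlice false (magnus Bool z one - one)) +
      lastSlice false (headSlice true (magnus Bool z one - one) +
      headSlice false (magnus Bool z one - one))) ?_ u rfl
  · simp only [Pi.add_apply, lastSlice_apply, headSlice_apply] at this
    linarith
  · intro v hv
    rw [← linSubst_append_false, ← linSubst, ← subst_eq_linSubst hz' (by simp; omega),
      hω _ _ _ (by omega)]
    simp

end Failure

open scoped IsMulCommutative

/-! ### Groups of nilpotency class two -/

section ClassTwo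

variable {G : Type*} [Group G]

theorem commutatorElement_mul_left_of_class_two (h2 : commutator G ≤ Subgroup.center G)
    (u v g : G) : ⁅u * v, g⁆ = ⁅u, g⁆ * ⁅v, g⁆ := by
  have hc := Subgroup.mem_center_iff.1
    (h2 (Subgroup.commutator_mem_commutator (Subgroup.mem_top v) (Subgroup.mem_top g)))
  have h : ⁅u * v, g⁆ = u * ⁅v, g⁆ * u⁻¹ * ⁅u, g⁆ := by
    simp only [commutatorElement_def]
    group
  rw [h, hc u, mul_inv_cancel_right, hc]

/-- In class two u ↦ [u,g] is a homomorphism with central values, so these products form a subgroup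
containing the conjugates ugu⁻¹ = [u,g]g. -/
theorem exists_of_mem_normalClosure (h2 : commutator G ≤ Subgroup.center G) {g x : G}
    (hx : x ∈ Subgroup.normalClosure {g}) : ∃ (u : G) (k : ℤ), x = ⁅u, g⁆ * g ^ k := by
  have hc := fun v => Subgroup.mem_center_iff.1
    (h2 (Subgroup.commutator_mem_commutator (Subgroup.mem_top v) (Subgroup.mem_top g)))
  induction hx using Subgroup.closure_induction with
  | mem x hx =>
    obtain ⟨y, rfl, hy⟩ := Group.mem_conjugatesOfSet_iff.1 hx
    obtain ⟨u, rfl⟩ := isConj_iff.1 hy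
    exact ⟨u, 1, by rw [commutatorElement_def]; group⟩
  | one => exact ⟨1, 0, by simp⟩
  | mul x y _ _ hx hy =>
    obtain ⟨u, k, rfl⟩ := hx
    obtain ⟨v, l, rfl⟩ := hy
    refine ⟨u * v, k + l, ?_⟩
    rw [commutatorElement_mul_left_of_class_two h2, zpow_add, mul_assoc, mul_assoc,
      ← mul_assoc (g ^ k), hc v, mul_assoc]
  | inv x _ hx =>
    obtain ⟨u, k, rfl⟩ := hx
    have : ⁅u⁻¹, g⁆ * ⁅u, g⁆ = 1 := by
      rw [← commutatorElement_mul_left_of_class_two h2]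
      simp
    refine ⟨u⁻¹, -k, ?_⟩
    rw [← hc, mul_inv_rev, eq_inv_of_mul_eq_one_left this, zpow_neg]

/-- A group of class at most two with torsion-free abelianization and torsion-free derived
subgroup has the Magnus property. -/
theorem magnusProperty_of_class_two (h2 : commutator G ≤ Subgroup.center G)
    (hab : ∀ (g : G) (k : ℤ), k ≠ 0 → g ^ k ∈ commutator G → g ∈ commutator G)
    (htf : ∀ g ∈ commutator G, ∀ k : ℤ, k ≠ 0 → g ^ k = 1 → g = 1) : MagnusProperty G := by
  intro g h hgh
  obtain ⟨u, k, hk⟩ := exists_of_mem_normalClosure h2 (g := g) (x := h)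
    (hgh ▸ Subgroup.subset_normalClosure (Set.mem_singleton h))
  obtain ⟨v, l, hl⟩ := exists_of_mem_normalClosure h2 (g := h) (x := g)
    (hgh ▸ Subgroup.subset_normalClosure (Set.mem_singleton g))
  by_cases hkl : k * l = 1
  · rcases Int.eq_one_or_neg_one_of_mul_eq_one hkl with rfl | rfl
    · left
      refine isConj_iff.2 ⟨u, ?_⟩
      rw [hk, commutatorElement_def]
      group
    · right
      refine isConj_iff.2 ⟨u⁻¹, ?_⟩
      have hc := Subgroup.mem_center_iff.1
        (h2 (Subgroup.commutator_mem_commutator (Subgroup.mem_top u⁻¹) (Subgroup.mem_top g)))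
      have : ⁅u⁻¹, g⁆ * ⁅u, g⁆ = 1 := by
        rw [← commutatorElement_mul_left_of_class_two h2]
        simp
      rw [hk, mul_inv_rev, ← eq_inv_of_mul_eq_one_left this, zpow_neg, zpow_one, inv_inv, hc,
        commutatorElement_def]
      group
  · left
    -- Modulo G' one has g = g^(kl), so g ∈ G' is central; then g = g^(kl) holds exactly and g = 1.
    have hne : k * l - 1 ≠ 0 := sub_ne_zero.2 hkl
    have hg : g ∈ commutator G := by
      refine hab g (k * l - 1) hne ?_
      rw [← QuotientGroup.eq_one_iff]
      have e1 : ((⁅u, g⁆ : G) : G ⧸ commutator G) = 1 := (QuotientGroup.eq_one_iff _).2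
        (Subgroup.commutator_mem_commutator (Subgroup.mem_top u) (Subgroup.mem_top g))
      have e2 : ((⁅v, h⁆ : G) : G ⧸ commutator G) = 1 := (QuotientGroup.eq_one_iff _).2
        (Subgroup.commutator_mem_commutator (Subgroup.mem_top v) (Subgroup.mem_top h))
      have h1 := congrArg (fun x : G => (x : G ⧸ commutator G)) hk
      have h2 := congrArg (fun x : G => (x : G ⧸ commutator G)) hl
      simp only [QuotientGroup.mk_mul, QuotientGroup.mk_zpow, e1, e2, one_mul] at h1 h2
      rw [QuotientGroup.mk_zpow, zpow_sub_one, zpow_mul, ← h1, ← h2, mul_inv_cancel]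
    have hcomm : ∀ w, ⁅w, g⁆ = 1 := fun w =>
      commutatorElement_eq_one_iff_mul_comm.2 (Subgroup.mem_center_iff.1 (h2 hg) w)
    rw [hcomm, one_mul] at hk
    have hh : h ∈ commutator G := hk ▸ zpow_mem hg k
    have hcomm' : ⁅v, h⁆ = 1 :=
      commutatorElement_eq_one_iff_mul_comm.2 (Subgroup.mem_center_iff.1 (h2 hh) v)
    rw [hcomm', one_mul] at hl
    have hg1 : g = 1 := by
      refine htf g hg _ hne ?_
      rw [zpow_sub_one, zpow_mul, ← hk, ← hl, mul_inv_cancel]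
    rw [hk, hg1, one_zpow]

end ClassTwo

/-! ### The free nilpotent group of class two -/

section FreeClassTwo

open WordSeries

theorem mem_commutator_of_zpow_mem {α : Type*} (g : FreeGroup α) (k : ℤ) (hk : k ≠ 0)
    (h : g ^ k ∈ commutator (FreeGroup α)) : g ∈ commutator (FreeGroup α) := by
  have key : ∀ x : FreeGroup α, x ∈ commutator (FreeGroup α) ↔
      (Additive.ofMul (Abelianization.of x) : FreeAbelianGroup α) = 0 := by
    intro x
    rw [← Abelianization.ker_of, MonoidHom.mem_ker]
    rfl
  rw [key] at h ⊢
  rw [map_zpow] at h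
  set a : FreeAbelianGroup α := Additive.ofMul (Abelianization.of g)
  have h' : k • a = 0 := h
  have := congrArg (FreeAbelianGroup.equivFinsupp α) h'
  rw [map_zsmul, map_zero, smul_eq_zero_iff_right hk] at this
  exact (FreeAbelianGroup.equivFinsupp α).map_eq_zero_iff.1 this

variable {ι : Type*} [DecidableEq ι]

theorem commutator_le_dimensionSubgroup :
    commutator (FreeGroup ι) ≤ dimensionSubgroup ι 2 := by
  rw [← Subgroup.top_lowerCentralSeries_one]
  exact lowerCentralSeries_le_dimensionSubgroup 1

/-- The coefficient of `ij` in the Magnus expansion. -/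
def quadCoeff (i j : ι) (g : FreeGroup ι) : ℤ := magnus ι g one [i, j]

theorem quadCoeff_mul {g : FreeGroup ι} (hg : g ∈ dimensionSubgroup ι 2) (h : FreeGroup ι)
    (i j : ι) : quadCoeff i j (g * h) = quadCoeff i j g + quadCoeff i j h := by
  rw [quadCoeff, magnus_mul, magnus_apply_of_mem hg _ (by simp)]
  simp [quadCoeff, add_comm]

theorem quadCoeff_of_mul_of (i j k l : ι) :
    quadCoeff k l (FreeGroup.of i * FreeGroup.of j) = if k = i ∧ l = j then 1 else 0 := by
  simp [quadCoeff, ite_and]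

theorem quadCoeff_commutator (i j k l : ι) :
    quadCoeff k l ⁅FreeGroup.of i, FreeGroup.of j⁆ =
      (if k = i ∧ l = j then 1 else 0) - (if k = j ∧ l = i then 1 else 0) := by
  have hmem := commutator_le_dimensionSubgroup (Subgroup.commutator_mem_commutator
    (Subgroup.mem_top (FreeGroup.of i)) (Subgroup.mem_top (FreeGroup.of j)))
  have h := quadCoeff_mul hmem (FreeGroup.of j * FreeGroup.of i) k l
  rw [show ⁅FreeGroup.of i, FreeGroup.of j⁆ * (FreeGroup.of j * FreeGroup.of i) =
      FreeGroup.of i * FreeGroup.of j by rw [commutatorElement_def]; group,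
    quadCoeff_of_mul_of, quadCoeff_of_mul_of] at h
  linarith

theorem quadCoeff_one (i j : ι) : quadCoeff i j (1 : FreeGroup ι) = 0 := by simp [quadCoeff]

theorem quadCoeff_eq_zero {g : FreeGroup ι} (hg : g ∈ dimensionSubgroup ι 3) (i j : ι) :
    quadCoeff i j g = 0 := by
  rw [quadCoeff, magnus_apply_eq_of_mem hg _ (by simp), one_cons]

theorem quadCoeff_zpow {g : FreeGroup ι} (hg : g ∈ dimensionSubgroup ι 2) (k : ℤ) (i j : ι) :
    quadCoeff i j (g ^ k) = k * quadCoeff i j g := by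
  induction k with
  | zero => simp [quadCoeff_one]
  | succ n ih => rw [add_comm, zpow_one_add, quadCoeff_mul hg, ih]; ring
  | pred n ih =>
    have := quadCoeff_mul hg (g ^ (-(n : ℤ) - 1)) i j
    rw [← zpow_one_add, show 1 + (-(n : ℤ) - 1) = -n by ring, ih] at this
    linarith

variable (ι) in
/-- The free nilpotent group of class two. -/
abbrev FreeClassTwo : Type _ :=
  FreeGroup ι ⧸ ⁅commutator (FreeGroup ι), (⊤ : Subgroup (FreeGroup ι))⁆

omit [DecidableEq ι] in
theorem quot_eq_one_iff {g : FreeGroup ι} : (g : FreeClassTwo ι) = 1 ↔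
    g ∈ ⁅commutator (FreeGroup ι), (⊤ : Subgroup (FreeGroup ι))⁆ := QuotientGroup.eq_one_iff g

omit [DecidableEq ι] in
theorem map_mk_commutator :
    (commutator (FreeGroup ι)).map (QuotientGroup.mk' _) = commutator (FreeClassTwo ι) := by
  refine (Subgroup.map_commutator _ _ _).trans ?_
  rw [Subgroup.map_top_of_surjective _ (QuotientGroup.mk'_surjective _)]
  rfl

omit [DecidableEq ι] in
theorem mk_mem_center {g : FreeGroup ι} (hg : g ∈ commutator (FreeGroup ι)) :
    (g : FreeClassTwo ι) ∈ Subgroup.center (FreeClassTwo ι) := by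
  rw [Subgroup.mem_center_iff]
  intro h
  obtain ⟨h, rfl⟩ := QuotientGroup.mk_surjective h
  have : ⁅(g : FreeClassTwo ι), (h : FreeClassTwo ι)⁆ = 1 := by
    exact (quot_eq_one_iff (g := ⁅g, h⁆)).2
      (Subgroup.commutator_mem_commutator hg (Subgroup.mem_top h))
  exact (commutatorElement_eq_one_iff_mul_comm.1 this).symm

variable {κ : Type*} [LinearOrder κ] [Fintype κ]

/-- The element of the centre of the free nilpotent group of class two with the same coordinates
as `g` with respect to the basic commutators. -/
def basicProduct (g : FreeGroup κ) : Subgroup.center (FreeClassTwo κ) :=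
  ∏ p : κ × κ with p.1 < p.2,
    (⟨(⁅FreeGroup.of p.1, FreeGroup.of p.2⁆ : FreeGroup κ), mk_mem_center
      (Subgroup.commutator_mem_commutator (Subgroup.mem_top _) (Subgroup.mem_top _))⟩ :
        Subgroup.center (FreeClassTwo κ)) ^ quadCoeff p.1 p.2 g

theorem basicProduct_mul {g : FreeGroup κ} (hg : g ∈ dimensionSubgroup κ 2) (h : FreeGroup κ) :
    basicProduct (g * h) = basicProduct g * basicProduct h := by
  simp only [basicProduct, quadCoeff_mul hg, zpow_add, Finset.prod_mul_distrib]

theorem basicProduct_commutator {i j : κ} (hij : i < j) :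
    (basicProduct ⁅FreeGroup.of i, FreeGroup.of j⁆ : FreeClassTwo κ) =
      (⁅FreeGroup.of i, FreeGroup.of j⁆ : FreeGroup κ) := by
  rw [basicProduct, Finset.prod_eq_single_of_mem (i, j) (by simpa using hij)]
  · simp [quadCoeff_commutator, hij.ne]
  · rintro ⟨k, l⟩ hkl hne
    have hkl : k < l := by simpa using hkl
    rw [quadCoeff_commutator, if_neg (by simpa using hne), if_neg]
    · simp
    · rintro ⟨rfl, rfl⟩
      exact hkl.asymm hij

/-- The elements of F' satisfying the equality form a normal subgroup containing the commutators of
generators, hence all of F'. Thus quadratic coefficients determine F' modulo γ₃. -/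
theorem basicProduct_eq {g : FreeGroup κ} (hg : g ∈ commutator (FreeGroup κ)) :
    (basicProduct g : FreeClassTwo κ) = g := by
  have h1 : basicProduct (1 : FreeGroup κ) = 1 := by simp [basicProduct, quadCoeff_one]
  let E : Subgroup (FreeGroup κ) :=
    { carrier := {g | g ∈ commutator (FreeGroup κ) ∧ (basicProduct g : FreeClassTwo κ) = g}
      one_mem' := ⟨one_mem _, by rw [h1]; rfl⟩
      mul_mem' := fun {a b} ha hb => ⟨mul_mem ha.1 hb.1, by
        rw [basicProduct_mul (commutator_le_dimensionSubgroup ha.1), Subgroup.coe_mul, ha.2, hb.2]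
        rfl⟩
      inv_mem' := fun {a} ha => ⟨inv_mem ha.1, by
        have := basicProduct_mul (commutator_le_dimensionSubgroup ha.1) a⁻¹
        rw [mul_inv_cancel, h1] at this
        rw [eq_inv_of_mul_eq_one_right this.symm, Subgroup.coe_inv, ha.2]
        rfl⟩ }
  -- Conjugation changes g by an element of γ₃, invisible both to quadratic coefficients and in the
  -- quotient.
  have hE : E.Normal := by
    refine ⟨fun g hg h => ?_⟩
    have hmem : h * g * h⁻¹ ∈ commutator (FreeGroup κ) :=
      Subgroup.Normal.conj_mem inferInstance g hg.1 h
    have hc : ⁅h, g⁆ ∈ ⁅commutator (FreeGroup κ), (⊤ : Subgroup (FreeGroup κ))⁆ := by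
      rw [Subgroup.commutator_comm]
      exact Subgroup.commutator_mem_commutator (Subgroup.mem_top h) hg.1
    have hD : ⁅h, g⁆ ∈ dimensionSubgroup κ 3 :=
      commutator_dimensionSubgroup_le 2
        (Subgroup.commutator_mono commutator_le_dimensionSubgroup le_rfl hc)
    have heq : h * g * h⁻¹ = ⁅h, g⁆ * g := by rw [commutatorElement_def]; group
    refine ⟨hmem, ?_⟩
    have hb : basicProduct ⁅h, g⁆ = 1 := by
      simp [basicProduct, quadCoeff_eq_zero hD]
    rw [heq, basicProduct_mul (dimensionSubgroup_antitone (by norm_num) hD), hb, one_mul, hg.2,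
      QuotientGroup.mk_mul, quot_eq_one_iff.2 hc, one_mul]
  refine (commutator_le_of_closure (FreeGroup.closure_range_of κ) (K := E) ?_ hg).2
  have hlt : ∀ i j : κ, i < j → ⁅FreeGroup.of i, FreeGroup.of j⁆ ∈ E := fun i j hij =>
    ⟨Subgroup.commutator_mem_commutator (Subgroup.mem_top _) (Subgroup.mem_top _),
      basicProduct_commutator hij⟩
  rintro _ ⟨i, rfl⟩ _ ⟨j, rfl⟩
  rcases lt_trichotomy i j with h | rfl | h
  · exact hlt i j h
  · rw [commutatorElement_self]
    exact one_mem E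
  · rw [← commutatorElement_inv]
    exact inv_mem (hlt j i h)

variable (κ) in
theorem magnusProperty_freeClassTwo : MagnusProperty (FreeClassTwo κ) := by
  refine magnusProperty_of_class_two ?_ ?_ ?_
  · rw [← map_mk_commutator]
    rintro _ ⟨g, hg, rfl⟩
    exact mk_mem_center hg
  · intro g k hk h
    obtain ⟨g, rfl⟩ := QuotientGroup.mk_surjective g
    rw [← map_mk_commutator] at h ⊢
    obtain ⟨x, hx, hxg⟩ := h
    refine Subgroup.mem_map_of_mem (QuotientGroup.mk' _) (mem_commutator_of_zpow_mem g k hk ?_)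
    have : x⁻¹ * g ^ k ∈ ⁅commutator (FreeGroup κ), (⊤ : Subgroup (FreeGroup κ))⁆ :=
      QuotientGroup.eq.1 hxg
    simpa using mul_mem hx (Subgroup.commutator_le_left _ _ this)
  · intro g hg k hk h
    rw [← map_mk_commutator] at hg
    obtain ⟨g, hg, rfl⟩ := hg
    have hgk : g ^ k ∈ ⁅commutator (FreeGroup κ), (⊤ : Subgroup (FreeGroup κ))⁆ :=
      quot_eq_one_iff.1 h
    have hD := commutator_dimensionSubgroup_le 2
      (Subgroup.commutator_mono commutator_le_dimensionSubgroup le_rfl hgk)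
    have hzero : ∀ i j, quadCoeff i j g = 0 := by
      intro i j
      have := quadCoeff_eq_zero hD i j
      rw [quadCoeff_zpow (commutator_le_dimensionSubgroup hg)] at this
      exact (mul_eq_zero.1 this).resolve_left hk
    change (g : FreeClassTwo κ) = 1
    rw [← basicProduct_eq hg]
    simp [basicProduct, hzero]

end FreeClassTwo

/-! ### The main theorem -/

theorem nilpotencyClass_le_two_iff {G : Type*} [Group G] :
    (Group.IsNilpotent G ∧ Group.nilpotencyClass G ≤ 2) ↔
      (⊤ : Subgroup G).lowerCentralSeries 2 = ⊥ := by
  refine ⟨fun ⟨_, h⟩ => Subgroup.lowerCentralSeries_eq_bot_iff_nilpotencyClass_le.2 h, fun h => ?_⟩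
  have : Group.IsNilpotent G := Subgroup.nilpotent_iff_lowerCentralSeries.2 ⟨2, h⟩
  exact ⟨this, Subgroup.lowerCentralSeries_eq_bot_iff_nilpotencyClass_le.1 h⟩

theorem lowerCentralSeries_eq_bot_of_surjective {G H : Type*} [Group G] [Group H] (f : G →* H)
    (hf : Function.Surjective f) {n : ℕ} (h : (⊤ : Subgroup G).lowerCentralSeries n = ⊥) :
    (⊤ : Subgroup H).lowerCentralSeries n = ⊥ := by
  rw [← Subgroup.map_top_of_surjective f hf, ← Subgroup.map_lowerCentralSeries, h,
    Subgroup.map_bot]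

theorem lowerCentralSeries_freeClassTwo (ι : Type*) :
    (⊤ : Subgroup (FreeClassTwo ι)).lowerCentralSeries 2 = ⊥ := by
  rw [← Subgroup.map_top_of_surjective _ (QuotientGroup.mk'_surjective _),
    ← Subgroup.map_lowerCentralSeries, Subgroup.map_eq_bot_iff, QuotientGroup.ker_mk']
  rfl

/-- A centre-by-polynilpotent free group of rank one, or with class row `(1)`, is a free nilpotent
group of class two. -/
theorem nonempty_mulEquiv_freeClassTwo {d : ℕ} {c : List ℕ} (h : d = 1 ∨ c = [1]) :
    Nonempty (FreeCentreByPolynilpotent d c ≃* FreeClassTwo (Fin d)) := by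
  refine ⟨QuotientGroup.quotientMulEquivOfEq ?_⟩
  rcases h with rfl | rfl
  -- In rank one F is abelian, so both subgroups factored out are trivial.
  · have hbot : ∀ S : Subgroup (FreeGroup (Fin 1)),
        ⁅S, (⊤ : Subgroup (FreeGroup (Fin 1)))⁆ = ⊥ := by
      intro S
      have hcomm : commutator (FreeGroup (Fin 1)) ≤ ⊥ := by
        refine commutator_le_of_closure (FreeGroup.closure_range_of _) ?_
        rintro _ ⟨i, rfl⟩ _ ⟨j, rfl⟩
        rw [Subsingleton.elim i j, commutatorElement_self]
        exact one_mem _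
      exact le_bot_iff.1 ((Subgroup.commutator_mono le_top le_rfl).trans hcomm)
    rw [hbot, hbot]
  · rfl

/-- Two generators of F span a retract (the remaining ones are sent to y), and iterated lower
central terms are functorial. -/
theorem exists_retract {d : ℕ} (hd : 2 ≤ d) (c : List ℕ) :
    ∃ (s : FreeGroup Bool ⧸ ⁅iteratedLowerCentral (FreeGroup Bool) c, (⊤ : Subgroup _)⁆ →*
        FreeCentreByPolynilpotent d c)
      (r : FreeCentreByPolynilpotent d c →*
        FreeGroup Bool ⧸ ⁅iteratedLowerCentral (FreeGroup Bool) c, (⊤ : Subgroup _)⁆),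
      ∀ x, r (s x) = x := by
  let i : FreeGroup Bool →* FreeGroup (Fin d) :=
    FreeGroup.lift fun b => FreeGroup.of (if b then ⟨0, by omega⟩ else ⟨1, by omega⟩)
  let p : FreeGroup (Fin d) →* FreeGroup Bool :=
    FreeGroup.lift fun k => FreeGroup.of (k.val == 0)
  have hpi : p.comp i = MonoidHom.id _ := by
    ext b
    cases b <;> simp [p, i]
  refine ⟨QuotientGroup.map _ _ i (commutator_iteratedLowerCentral_le_comap i c),
    QuotientGroup.map _ _ p (commutator_iteratedLowerCentral_le_comap p c), fun x => ?_⟩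
  obtain ⟨x, rfl⟩ := QuotientGroup.mk_surjective x
  rw [QuotientGroup.map_mk, QuotientGroup.map_mk]
  exact congrArg _ (DFunLike.congr_fun hpi x)

theorem theorem2 (d : ℕ) (hd : 1 ≤ d) (c : List ℕ) (hc : c ≠ []) (hc_pos : ∀ n ∈ c, 1 ≤ n)
    (G : Type*) [Group G] (hG : Nonempty (G ≃* FreeCentreByPolynilpotent d c)) :
    (MagnusProperty G ↔ (Group.IsNilpotent G ∧ Group.nilpotencyClass G ≤ 2)) ∧
      (MagnusProperty G ↔ (d = 1 ∨ c = [1])) := by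
  obtain ⟨e⟩ := hG
  rw [nilpotencyClass_le_two_iff]
  by_cases h : d = 1 ∨ c = [1]
  · obtain ⟨e'⟩ := nonempty_mulEquiv_freeClassTwo h
    have hM : MagnusProperty G :=
      (MagnusProperty.congr (e.trans e')).2 (magnusProperty_freeClassTwo (Fin d))
    have hN : (⊤ : Subgroup G).lowerCentralSeries 2 = ⊥ :=
      lowerCentralSeries_eq_bot_of_surjective (e.trans e').symm.toMonoidHom
        (e.trans e').symm.surjective (lowerCentralSeries_freeClassTwo (Fin d))
    exact ⟨iff_of_true hM hN, iff_of_true hM h⟩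
  · push Not at h
    obtain ⟨s, r, hrs⟩ := exists_retract (by omega : 2 ≤ d) c
    have hle := iteratedLowerCentral_le (G := FreeGroup Bool) hc hc_pos h.2
    have hne : iteratedLowerCentral (FreeGroup Bool) c ≠ ⊥ := fun hbot =>
      not_isSolvable_freeGroup_bool (isSolvable_of_iteratedLowerCentral_eq_bot c hbot)
    have hM : ¬ MagnusProperty G := by
      rw [MagnusProperty.congr e]
      intro hM
      refine not_magnusProperty hle hne ?_ (hM.of_retract s r hrs)
      intro z hz
      exact map_iteratedLowerCentral_le WordSeries.transvection c (Subgroup.mem_map_of_mem _ hz)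
    have hN : ¬ (⊤ : Subgroup G).lowerCentralSeries 2 = ⊥ := by
      intro hN
      have hsurj : Function.Surjective (r.comp e.toMonoidHom) :=
        (show Function.Surjective r from fun x => ⟨s x, hrs x⟩).comp e.surjective
      have hbot := lowerCentralSeries_eq_bot_of_surjective _ hsurj hN
      rw [← Subgroup.map_top_of_surjective _ (QuotientGroup.mk'_surjective _),
        ← Subgroup.map_lowerCentralSeries, Subgroup.map_eq_bot_iff,
        QuotientGroup.ker_mk'] at hbot
      exact not_lowerCentralSeries_two_le hle hne hbot
    exact ⟨iff_of_false hM hN, iff_of_false hM (not_or.2 h)⟩
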